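/- Let $\Omega$ be a compact metric space and let $\Delta(\Omega)$ be the set of Borel probability measures on $\Omega$ with the weak$^\star$ topology. Let $\mu_0\in\Delta(\Omega)$ have full support and let $V:\Delta(\Omega)\to\mathbb{R}$ be upper semi-continuous. The primal problem (P) is to maximize $\int_{\Delta(\Omega)}V(\mu)\,\mathrm{d}\tau(\mu)$ (which may take the value $-\infty$) over the Borel probability measures $\tau\in\Delta(\Delta(\Omega))$ with $\int_{\Delta(\Omega)}\mu\,\mathrm{d}\tau(\mu)=\mu_0$. The dual problem (D) is to minimize $\int_\Omega P\,\mathrm{d}\mu_0$ over the continuous functions $P:\Omega\to\mathbb{R}$ with $\int_\Omega P\,\mathrm{d}\mu\ge V(\mu)$ for all $\mu\in\Delta(\Omega)$. The concave closure of $V$ is $$\widehat V(\mu)=\inf\{H(\mu) : H:\Delta(\Omega)\to\mathbb{R}\text{ affine and continuous},\ H\ge V\}.$$ A supporting hyperplane of $\widehat V$ at $\mu_0$ is an affine continuous function $\overline V:\Delta(\Omega)\to\mathbb{R}$ with $\overline V(\mu_0)=\widehat V(\mu_0)$ and $\overline V(\mu)\ge\widehat V(\mu)$ for all $\mu\in\Delta(\Omega)$;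 the problem is called regular if such a function exists. **Theorem (Strong duality).** 1. The problems (P) and (D) have optimal solutions $\tau$ and $P$, respectively, that satisfy $$\int_\Omega P\,\mathrm{d}\mu_0=\int_{\Delta(\Omega)}V\,\mathrm{d}\tau \tag{O}$$ if and only if the problem is regular. 2. If $\overline V$ is a supporting hyperplane of $\widehat V$ at $\mu_0$, then $P^\star(\omega)=\overline V(\delta_\omega)$, where $\delta_\omega$ is the Dirac measure at $\omega$, is a continuous function on $\Omega$ and an optimal solution of (D), and (O) holds for $P^\star$ and some optimal solution $\tau$ of (P). 3. Conversely, for every optimal solution $P$ of (D) there is a supporting hyperplane $\overline V$ of $\widehat V$ at $\mu_0$ such that $P(\omega)=\overline V(\delta_\omega)$ for all $\omega\in\Omega$. -/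

import Mathlib

open MeasureTheory
open scoped NNReal ENNReal

namespace Persuasion

section Borel

variable {Ω : Type*} [MetricSpace Ω] [CompactSpace Ω] [MeasurableSpace Ω] [BorelSpace Ω]

/-- On the space of Borel probability measures of a compact metric space, the measurable structure
provided by Mathlib (generated by the evaluations `μ ↦ μ A`) is the Borel sigma-algebra of the weak
(weak-star) topology. Hence the measures on `ProbabilityMeasure Ω` used below are exactly the Borel
measures. -/
instance borelSpace_probabilityMeasure : BorelSpace (ProbabilityMeasure Ω) := by
  constructor
  apply le_antisymm
  · have key : @Measurable _ _ (borel (ProbabilityMeasure Ω)) _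
        (fun μ : ProbabilityMeasure Ω => (μ : Measure Ω)) := by
      let : MeasurableSpace (ProbabilityMeasure Ω) := borel _
      have : BorelSpace (ProbabilityMeasure Ω) := ⟨rfl⟩
      refine Measurable.measure_of_isPiSystem_of_isProbabilityMeasure
        (S := {s | IsOpen s}) (BorelSpace.measurable_eq) isPiSystem_isOpen ?_
      intro s hs
      apply LowerSemicontinuous.measurable
      rw [lowerSemicontinuous_iff_le_liminf]
      intro μ
      exact ProbabilityMeasure.le_liminf_measure_open_of_tendsto (Filter.tendsto_id) hs
    exact key.comap_le
  · have : SecondCountableTopology (ProbabilityMeasure Ω) := by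
      let := TopologicalSpace.metrizableSpaceMetric (ProbabilityMeasure Ω)
      infer_instance
    have hT : (inferInstance : TopologicalSpace (ProbabilityMeasure Ω)) =
        TopologicalSpace.generateFrom
          {U | ∃ (f : BoundedContinuousFunction Ω ℝ≥0) (W : Set ℝ≥0), IsOpen W ∧
            U = (fun μ : ProbabilityMeasure Ω => μ.toWeakDualBCNN f) ⁻¹' W} := by
      apply le_antisymm
      · refine le_generateFrom ?_
        rintro U ⟨f, W, hW, rfl⟩
        exact hW.preimage (ProbabilityMeasure.continuous_testAgainstNN_eval f)
      · rw [← continuous_id_iff_le]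
        refine (@continuous_induced_rng _ _ _ _ _ _ (_)).2 ?_
        refine (@continuous_induced_rng _ _ _ _ _ _ (_)).2 ?_
        refine (@continuous_induced_rng _ _ _ _ _ _ (_)).2 ?_
        refine (@continuous_pi_iff _ _ _ (_) _ _).2 ?_
        intro f
        refine (@continuous_def _ _ (_) _ _).2 ?_
        intro W hW
        exact TopologicalSpace.isOpen_generateFrom_of_mem ⟨f, W, hW, rfl⟩
    rw [borel_eq_generateFrom_of_subbasis hT]
    refine MeasurableSpace.generateFrom_le ?_
    rintro U ⟨f, W, hW, rfl⟩
    have hm : Measurable (fun μ : ProbabilityMeasure Ω => μ.toWeakDualBCNN f) := by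
      have h1 : Measurable (fun μ : ProbabilityMeasure Ω =>
          (∫⁻ x, (f x : ℝ≥0∞) ∂(μ : Measure Ω))) :=
        (Measure.measurable_lintegral
          (f.continuous.measurable.coe_nnreal_ennreal)).comp measurable_subtype_coe
      exact h1.ennreal_toNNReal
    exact hm hW.measurableSet

end Borel

section Problems

variable {Ω : Type*} [MeasurableSpace Ω]

/-- The value `∫ V dτ` of a distribution of posteriors `τ`, with values in the extended reals: the
integral of the positive part minus the integral of the negative part. An upper semicontinuous `V`
on a compact space is bounded above but may be unbounded below, so that the integral is either
finite or `-∞`. -/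
noncomputable def primalValue (V : ProbabilityMeasure Ω → ℝ)
    (τ : ProbabilityMeasure (ProbabilityMeasure Ω)) : EReal :=
  ((∫⁻ μ, ENNReal.ofReal (V μ) ∂(τ : Measure (ProbabilityMeasure Ω)) : ℝ≥0∞) : EReal) -
    ((∫⁻ μ, ENNReal.ofReal (-V μ) ∂(τ : Measure (ProbabilityMeasure Ω)) : ℝ≥0∞) : EReal)

/-- Feasibility in the primal problem: the barycenter `∫ μ dτ(μ)` is the prior `μ₀`. -/
def IsPrimalFeasible (μ₀ : ProbabilityMeasure Ω)
    (τ : ProbabilityMeasure (ProbabilityMeasure Ω)) : Prop :=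
  ∀ A : Set Ω, MeasurableSet A →
    ∫⁻ μ, (μ : Measure Ω) A ∂(τ : Measure (ProbabilityMeasure Ω)) = (μ₀ : Measure Ω) A

/-- `τ` is an optimal solution of the primal problem (P). -/
def IsPrimalOptimal (V : ProbabilityMeasure Ω → ℝ) (μ₀ : ProbabilityMeasure Ω)
    (τ : ProbabilityMeasure (ProbabilityMeasure Ω)) : Prop :=
  IsPrimalFeasible μ₀ τ ∧ ∀ τ' : ProbabilityMeasure (ProbabilityMeasure Ω),
    IsPrimalFeasible μ₀ τ' → primalValue V τ' ≤ primalValue V τ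

/-- Affine functions on the convex set of probability measures: whenever `ρ` is the mixture
`a μ + b ν` with weights `a, b ≥ 0`, `a + b = 1`, one has `H ρ = a H μ + b H ν`. -/
def IsAffine (H : ProbabilityMeasure Ω → ℝ) : Prop :=
  ∀ (μ ν ρ : ProbabilityMeasure Ω) (a b : ℝ≥0), a + b = 1 →
    (ρ : Measure Ω) = a • (μ : Measure Ω) + b • (ν : Measure Ω) →
    H ρ = a * H μ + b * H ν

variable [TopologicalSpace Ω]

/-- Feasibility of a price function in the dual problem. -/
def IsDualFeasible (V : ProbabilityMeasure Ω → ℝ) (P : C(Ω, ℝ)) : Prop :=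
  ∀ μ : ProbabilityMeasure Ω, V μ ≤ ∫ ω, P ω ∂(μ : Measure Ω)

/-- `P` is an optimal solution of the dual problem (D). -/
def IsDualOptimal (V : ProbabilityMeasure Ω → ℝ) (μ₀ : ProbabilityMeasure Ω)
    (P : C(Ω, ℝ)) : Prop :=
  IsDualFeasible V P ∧ ∀ P' : C(Ω, ℝ), IsDualFeasible V P' →
    ∫ ω, P ω ∂(μ₀ : Measure Ω) ≤ ∫ ω, P' ω ∂(μ₀ : Measure Ω)

/-- Condition (O): the primal value of `τ` equals the dual value of `P`. -/
def EqualValues (V : ProbabilityMeasure Ω → ℝ) (μ₀ : ProbabilityMeasure Ω)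
    (τ : ProbabilityMeasure (ProbabilityMeasure Ω)) (P : C(Ω, ℝ)) : Prop :=
  ((∫ ω, P ω ∂(μ₀ : Measure Ω) : ℝ) : EReal) = primalValue V τ

/-- Strong duality: both problems have optimal solutions, and these satisfy (O). -/
def StrongDuality (V : ProbabilityMeasure Ω → ℝ) (μ₀ : ProbabilityMeasure Ω) : Prop :=
  ∃ (τ : ProbabilityMeasure (ProbabilityMeasure Ω)) (P : C(Ω, ℝ)),
    IsPrimalOptimal V μ₀ τ ∧ IsDualOptimal V μ₀ P ∧ EqualValues V μ₀ τ P

variable [OpensMeasurableSpace Ω]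

/-- The concave closure of `V` at `μ`: the infimum of `H μ` over all affine continuous `H ≥ V`.
For `V` bounded above, the set is nonempty, and it is bounded below by `V μ`. -/
noncomputable def concaveClosure (V : ProbabilityMeasure Ω → ℝ) (μ : ProbabilityMeasure Ω) : ℝ :=
  sInf {r : ℝ | ∃ H : ProbabilityMeasure Ω → ℝ,
    IsAffine H ∧ Continuous H ∧ (∀ ν, V ν ≤ H ν) ∧ r = H μ}

/-- `Vbar` is a supporting hyperplane of the concave closure of `V` at `μ₀`. -/
def IsSupportingHyperplane (V : ProbabilityMeasure Ω → ℝ) (μ₀ : ProbabilityMeasure Ω)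
    (Vbar : ProbabilityMeasure Ω → ℝ) : Prop :=
  IsAffine Vbar ∧ Continuous Vbar ∧ Vbar μ₀ = concaveClosure V μ₀ ∧
    ∀ μ, concaveClosure V μ ≤ Vbar μ

/-- The persuasion problem is regular: the concave closure is superdifferentiable at the prior. -/
def Regular (V : ProbabilityMeasure Ω → ℝ) (μ₀ : ProbabilityMeasure Ω) : Prop :=
  ∃ Vbar : ProbabilityMeasure Ω → ℝ, IsSupportingHyperplane V μ₀ Vbar

end Problems

end Persuasion

open Filter Topology

namespace Persuasion

/-! Affine continuous functions on the space of probability measures are exactly the integrals of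
continuous prices (`isAffine_integral`, `IsAffine.eq_integral`). So the concave closure at `μ₀` is
the infimum of the dual, and supporting hyperplanes correspond to dual optimal solutions.

The remaining content is that there is no gap and that the primal attains its value
(`exists_isPrimalFeasible_le_primalValue`). The functional `∫ P dμ ↦ ∫ P dμ₀` is extended by M.
Riesz to all continuous functions of `μ`, nonnegative on the cone generated by the functions above
`V - c`, and Riesz–Markov represents it by some `τ`. Its values on integrals give the barycenter;
its positivity on the cone gives `∫ V dτ ≥ c`, by approximating `V` from above. This step does not
need regularity, which governs only dual attainment. -/

/-! ### Semicontinuous approximation and representing measures -/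

/-- An upper semicontinuous function bounded above on a metrizable space is the pointwise limit of
continuous functions lying above it and below any of its upper bounds. -/
theorem exists_continuous_tendsto_of_upperSemicontinuous {X : Type*} [TopologicalSpace X]
    [TopologicalSpace.MetrizableSpace X] {V : X → ℝ} (hV : UpperSemicontinuous V) {M : ℝ}
    (hM : ∀ x, V x ≤ M) :
    ∃ f : ℕ → C(X, ℝ), (∀ n x, V x ≤ f n x) ∧ (∀ n x, f n x ≤ M) ∧
      ∀ x, Tendsto (fun n => f n x) atTop (𝓝 (V x)) := by
  let := TopologicalSpace.metrizableSpaceMetric X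
  -- The approximants are the sup-convolutions of `V` with the penalty `n * dist`; they are
  -- `n`-Lipschitz.
  have hbd (n : ℕ) (x : X) : BddAbove (Set.range fun y => V y - n * dist x y) := by
    refine ⟨M, ?_⟩
    rintro _ ⟨y, rfl⟩
    have : 0 ≤ (n : ℝ) * dist x y := by positivity
    have := hM y
    dsimp only
    linarith
  have hlip (n : ℕ) : LipschitzWith (n : ℝ≥0) fun x => ⨆ y, (V y - n * dist x y) := by
    refine LipschitzWith.of_le_add_mul _ fun x x' => ?_
    have : Nonempty X := ⟨x⟩
    refine ciSup_le fun y => ?_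
    have h1 := le_ciSup (hbd n x') y
    have h2 : (n : ℝ) * dist x' y ≤ n * (dist x x' + dist x y) := by
      gcongr
      rw [dist_comm x x']
      exact dist_triangle _ _ _
    simp only [NNReal.coe_natCast]
    linarith
  have hle (n : ℕ) (x : X) : V x ≤ ⨆ y, (V y - n * dist x y) := by
    simpa using le_ciSup (hbd n x) x
  refine ⟨fun n => ⟨_, (hlip n).continuous⟩, hle, fun n x => ?_, fun x => ?_⟩
  · have : Nonempty X := ⟨x⟩
    refine ciSup_le fun y => ?_
    have : 0 ≤ (n : ℝ) * dist x y := by positivity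
    linarith [hM y]
  · have : Nonempty X := ⟨x⟩
    refine tendsto_order.2 ⟨fun a ha => Eventually.of_forall fun n => ha.trans_le (hle n x),
      fun a ha => ?_⟩
    obtain ⟨b, hb, hba⟩ := exists_between ha
    obtain ⟨δ, hδ, hball⟩ := Metric.eventually_nhds_iff.1 (hV x b hb)
    -- For such `n` the penalty outside the `δ`-ball is at least `M - b`, so distant points
    -- contribute at most `b`, as do near ones.
    filter_upwards [eventually_ge_atTop ⌈(M - b) / δ⌉₊] with n hn
    refine lt_of_le_of_lt (ciSup_le fun y => ?_) hba
    by_cases hy : dist y x < δ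
    · have : 0 ≤ (n : ℝ) * dist x y := by positivity
      linarith [hball hy]
    · have h1 : (M - b) / δ ≤ n := Nat.ceil_le.1 hn
      rw [div_le_iff₀ hδ] at h1
      have h2 : (n : ℝ) * δ ≤ n * dist x y := by
        gcongr
        rw [dist_comm]
        exact not_lt.1 hy
      linarith [hM y]

/-- If `∫ f ∂τ ≥ c` for all continuous functions `f` above an upper semicontinuous function `V`
bounded above, then `V` is integrable and `∫ V ∂τ ≥ c`. -/
theorem integrable_and_le_integral_of_upperSemicontinuous {X : Type*} [TopologicalSpace X]
    [TopologicalSpace.MetrizableSpace X] [CompactSpace X] [MeasurableSpace X] [BorelSpace X]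
    {V : X → ℝ} (hV : UpperSemicontinuous V) {M : ℝ} (hM : ∀ x, V x ≤ M)
    (τ : Measure X) [IsProbabilityMeasure τ] {c : ℝ}
    (hc : ∀ f : C(X, ℝ), (∀ x, V x ≤ f x) → c ≤ ∫ x, f x ∂τ) :
    Integrable V τ ∧ c ≤ ∫ x, V x ∂τ := by
  obtain ⟨f, hVf, hfM, hf⟩ := exists_continuous_tendsto_of_upperSemicontinuous hV hM
  have hint (n : ℕ) : Integrable (f n) τ :=
    (f n).continuous.integrable_of_hasCompactSupport (HasCompactSupport.of_compactSpace _)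
  have hcM : 0 ≤ M - c := by
    have h1 := hc (f 0) (hVf 0)
    have h2 : ∫ x, f 0 x ∂τ ≤ ∫ _, M ∂τ := integral_mono (hint 0) (integrable_const _) (hfM 0)
    simp only [integral_const, probReal_univ, one_smul] at h2
    linarith
  -- Fatou for the nonnegative `M - f n` requires no lower bound on `V` and yields its integrability
  -- as well.
  have hlim (x : X) : ENNReal.ofReal (M - V x) =
      liminf (fun n => ENNReal.ofReal (M - f n x)) atTop :=
    ((ENNReal.continuous_ofReal.tendsto _).comp ((hf x).const_sub M)).liminf_eq.symm
  have hn (n : ℕ) : ∫⁻ x, ENNReal.ofReal (M - f n x) ∂τ ≤ ENNReal.ofReal (M - c) := by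
    have hsub : Integrable (fun x => M - f n x) τ := (integrable_const M).sub (hint n)
    rw [← ofReal_integral_eq_lintegral_ofReal hsub
      (Eventually.of_forall fun x => sub_nonneg.2 (hfM n x)),
      integral_sub (integrable_const M) (hint n)]
    simp only [integral_const, probReal_univ, one_smul]
    exact ENNReal.ofReal_le_ofReal (by linarith [hc (f n) (hVf n)])
  have hle : ∫⁻ x, ENNReal.ofReal (M - V x) ∂τ ≤ ENNReal.ofReal (M - c) := by
    simp only [hlim]
    refine (lintegral_liminf_le fun n => ?_).trans ?_
    · exact (continuous_const.sub (f n).continuous).measurable.ennreal_ofReal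
    · exact (liminf_le_liminf (Eventually.of_forall hn)).trans (by simp)
  have hVm : Measurable V := hV.measurable
  have hnn : 0 ≤ᵐ[τ] fun x => M - V x := Eventually.of_forall fun x => sub_nonneg.2 (hM x)
  have hsub : Integrable (fun x => M - V x) τ :=
    (lintegral_ofReal_ne_top_iff_integrable (measurable_const.sub hVm).aestronglyMeasurable
      hnn).1 (hle.trans_lt ENNReal.ofReal_lt_top).ne
  have hVi : Integrable V τ :=
    ((integrable_const M).sub hsub).congr (Eventually.of_forall fun x => sub_sub_cancel M (V x))
  refine ⟨hVi, ?_⟩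
  rw [← ofReal_integral_eq_lintegral_ofReal hsub hnn, ENNReal.ofReal_le_ofReal_iff hcM,
    integral_sub (integrable_const M) hVi] at hle
  simp only [integral_const, probReal_univ, one_smul] at hle
  linarith

/-- A positive normalized linear functional on the continuous functions of a compact Hausdorff
space is the integral against a probability measure. -/
theorem exists_probabilityMeasure_integral_eq {X : Type*} [TopologicalSpace X] [T2Space X]
    [CompactSpace X] [MeasurableSpace X] [BorelSpace X] (L : C(X, ℝ) →ₗ[ℝ] ℝ)
    (hL : ∀ f : C(X, ℝ), (∀ x, 0 ≤ f x) → 0 ≤ L f) (hone : L 1 = 1) :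
    ∃ τ : ProbabilityMeasure X, ∀ f : C(X, ℝ), ∫ x, f x ∂(τ : Measure X) = L f := by
  let Λ : CompactlySupportedContinuousMap X ℝ →ₚ[ℝ] ℝ := PositiveLinearMap.mk₀
    { toFun := fun f => L f.toContinuousMap
      map_add' := fun f g => L.map_add f.toContinuousMap g.toContinuousMap
      map_smul' := fun r f => L.map_smul r f.toContinuousMap }
    (fun f hf => hL _ fun x => hf x)
  have key (f : C(X, ℝ)) : ∫ x, f x ∂(RealRMK.rieszMeasure Λ) = L f :=
    RealRMK.integral_rieszMeasure Λ (CompactlySupportedContinuousMap.continuousMapEquiv f)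
  have hprob : IsProbabilityMeasure (RealRMK.rieszMeasure Λ) := by
    have h := key 1
    rw [hone] at h
    simp only [ContinuousMap.one_apply, integral_const, smul_eq_mul, mul_one] at h
    refine ⟨?_⟩
    rw [measureReal_def] at h
    rwa [ENNReal.toReal_eq_one_iff] at h
  exact ⟨⟨_, hprob⟩, key⟩

/-! ### Affine functions on finitely supported measures -/

section Affine

variable {Ω : Type*} [MeasurableSpace Ω]

/-- An affine function of measures is determined on finitely supported measures by its values at
the Dirac measures. -/
theorem IsAffine.eq_sum_of_finite {H : ProbabilityMeasure Ω → ℝ} (hH : IsAffine H)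
    (s : Finset Ω) : ∀ (w : Ω → ℝ≥0) (ρ : ProbabilityMeasure Ω), ∑ x ∈ s, w x = 1 →
      (ρ : Measure Ω) = ∑ x ∈ s, w x • Measure.dirac x →
      H ρ = ∑ x ∈ s, w x * H (diracProba x) := by
  classical
  induction s using Finset.induction_on with
  | empty => intro w ρ hw; simp at hw
  | insert a s ha ih =>
    intro w ρ hw hρ
    rw [Finset.sum_insert ha] at hw hρ ⊢
    -- Without mass on `s` there is nothing to normalize and `ρ` is Dirac; otherwise `ρ` mixes `δ_a`
    -- with the rest rescaled by `b⁻¹`.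
    by_cases hb : ∑ x ∈ s, w x = 0
    · have hz := (Finset.sum_eq_zero_iff.1 hb)
      have h1 : w a = 1 := by simpa [hb] using hw
      have h2 : ∑ x ∈ s, w x • Measure.dirac x = (0 : Measure Ω) :=
        Finset.sum_eq_zero fun x hx => by rw [hz x hx, zero_smul]
      have h3 : ρ = diracProba a := by
        apply Subtype.ext
        rw [h1, h2, one_smul, add_zero] at hρ
        exact hρ
      have h4 : ∑ x ∈ s, (w x : ℝ) * H (diracProba x) = 0 :=
        Finset.sum_eq_zero fun x hx => by rw [hz x hx]; simp
      rw [h1, h3, h4]; simp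
    · set b := ∑ x ∈ s, w x with hbdef
      have hν : IsProbabilityMeasure (∑ x ∈ s, (b⁻¹ * w x) • Measure.dirac x : Measure Ω) := by
        refine ⟨?_⟩
        rw [Measure.finsetSum_apply]
        simp only [Measure.smul_apply, measure_univ, ENNReal.smul_def, smul_eq_mul, mul_one]
        rw [← ENNReal.ofNNReal_finsetSum, ← Finset.mul_sum, ← hbdef, inv_mul_cancel₀ hb]
        simp
      have h1 := ih (fun x => b⁻¹ * w x) ⟨_, hν⟩
        (by rw [← Finset.mul_sum, ← hbdef, inv_mul_cancel₀ hb]) rfl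
      have h2 := hH (diracProba a) ⟨_, hν⟩ ρ (w a) b hw (by
        rw [hρ]
        congr 1
        simp only [ProbabilityMeasure.coe_mk, Finset.smul_sum, smul_smul, ← mul_assoc,
          mul_inv_cancel₀ hb, one_mul])
      rw [h2, h1, Finset.mul_sum]
      congr 1
      refine Finset.sum_congr rfl fun x _ => ?_
      have : (b : ℝ) ≠ 0 := by exact_mod_cast hb
      push_cast
      field_simp

/-- The image of a measure under a simple function is finitely supported. -/
theorem map_simpleFunc_eq_sum (f : SimpleFunc Ω Ω) (μ : Measure Ω) :
    μ.map f = ∑ x ∈ f.range, μ (f ⁻¹' {x}) • Measure.dirac x := by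
  classical
  ext A hA
  rw [Measure.map_apply f.measurable hA, Measure.finsetSum_apply]
  have h := sum_measure_preimage_singleton (μ := μ) (f.range.filter (· ∈ A))
    (fun y _ => f.measurableSet_fiber y)
  have h' : f ⁻¹' A = f ⁻¹' (f.range.filter (· ∈ A) : Finset Ω) := by
    ext x; simp
  rw [h', ← h, Finset.sum_filter]
  refine Finset.sum_congr rfl fun x _ => ?_
  by_cases hx : x ∈ A <;> simp [hA, hx]

end Affine

/-! ### Primal values and barycenters -/

section Value

variable {Ω : Type*} [MeasurableSpace Ω]

theorem primalValue_eq_integral {V : ProbabilityMeasure Ω → ℝ}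
    {τ : ProbabilityMeasure (ProbabilityMeasure Ω)}
    (h : Integrable V (τ : Measure (ProbabilityMeasure Ω))) :
    primalValue V τ = ((∫ μ, V μ ∂(τ : Measure (ProbabilityMeasure Ω)) : ℝ) : EReal) := by
  have hneg : ∫⁻ μ, ENNReal.ofReal (-V μ) ∂(τ : Measure (ProbabilityMeasure Ω)) ≠ ∞ :=
    h.neg.lintegral_lt_top.ne
  rw [integral_eq_lintegral_pos_part_sub_lintegral_neg_part h, EReal.coe_sub,
    EReal.coe_ennreal_toReal h.lintegral_lt_top.ne,
    EReal.coe_ennreal_toReal hneg]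
  rfl

/-- The upper bound makes the positive part finite, so a nonintegrable `V` has value `-∞` and only
the integrable case matters. -/
theorem primalValue_le_of_forall_integrable {V : ProbabilityMeasure Ω → ℝ} (hV : Measurable V)
    {M : ℝ} (hM : ∀ μ, V μ ≤ M) {τ : ProbabilityMeasure (ProbabilityMeasure Ω)} {c : ℝ}
    (h : Integrable V (τ : Measure (ProbabilityMeasure Ω)) →
      ∫ μ, V μ ∂(τ : Measure (ProbabilityMeasure Ω)) ≤ c) : primalValue V τ ≤ c := by
  have hpos : ∫⁻ μ, ENNReal.ofReal (V μ) ∂(τ : Measure (ProbabilityMeasure Ω)) ≠ ∞ := by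
    refine ne_top_of_le_ne_top (b := ENNReal.ofReal M) ENNReal.ofReal_ne_top ?_
    refine (lintegral_mono fun μ => ENNReal.ofReal_le_ofReal (hM μ)).trans ?_
    simp
  by_cases hneg : ∫⁻ μ, ENNReal.ofReal (-V μ) ∂(τ : Measure (ProbabilityMeasure Ω)) = ∞
  · rw [primalValue, hneg, EReal.coe_ennreal_top, EReal.sub_top]
    exact bot_le
  · have hi : Integrable V (τ : Measure (ProbabilityMeasure Ω)) := by
      refine ⟨hV.aestronglyMeasurable, ?_⟩
      rw [hasFiniteIntegral_iff_norm]
      calc ∫⁻ μ, ENNReal.ofReal ‖V μ‖ ∂(τ : Measure (ProbabilityMeasure Ω))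
          ≤ ∫⁻ μ, (ENNReal.ofReal (V μ) + ENNReal.ofReal (-V μ))
              ∂(τ : Measure (ProbabilityMeasure Ω)) := by
            refine lintegral_mono fun μ => ?_
            rw [Real.norm_eq_abs]
            rcases abs_cases (V μ) with ⟨h1, _⟩ | ⟨h1, _⟩ <;> rw [h1] <;> simp
        _ < ∞ := by
            rw [lintegral_add_left hV.ennreal_ofReal]
            exact ENNReal.add_lt_top.2 ⟨hpos.lt_top, lt_top_iff_ne_top.2 hneg⟩
    rw [primalValue_eq_integral hi]
    exact_mod_cast h hi

theorem isPrimalFeasible_iff_bind {μ₀ : ProbabilityMeasure Ω}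
    {τ : ProbabilityMeasure (ProbabilityMeasure Ω)} :
    IsPrimalFeasible μ₀ τ ↔
      (τ : Measure (ProbabilityMeasure Ω)).bind (fun μ => (μ : Measure Ω)) = μ₀ := by
  have hm : AEMeasurable (fun μ : ProbabilityMeasure Ω => (μ : Measure Ω))
    (τ : Measure (ProbabilityMeasure Ω)) := measurable_subtype_coe.aemeasurable
  refine ⟨fun h => ?_, fun h A hA => ?_⟩
  · ext A hA
    rw [Measure.bind_apply hA hm, h A hA]
  · rw [← h, Measure.bind_apply hA hm]

theorem isProbabilityMeasure_bind_coe (τ : ProbabilityMeasure (ProbabilityMeasure Ω)) :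
    IsProbabilityMeasure
      ((τ : Measure (ProbabilityMeasure Ω)).bind (fun μ => (μ : Measure Ω))) :=
  isProbabilityMeasure_bind measurable_subtype_coe.aemeasurable
    (Eventually.of_forall fun μ => μ.2)

end Value

/-! ### Integrals of prices and weak duality -/

variable {Ω : Type*} [MetricSpace Ω] [CompactSpace Ω] [MeasurableSpace Ω] [BorelSpace Ω]

theorem integrable_continuousMap {X : Type*} [TopologicalSpace X] [CompactSpace X]
    [MeasurableSpace X] [OpensMeasurableSpace X] (P : C(X, ℝ)) (μ : ProbabilityMeasure X) :
    Integrable P (μ : Measure X) :=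
  (BoundedContinuousFunction.mkOfCompact P).integrable _

theorem continuous_integral_continuousMap (P : C(Ω, ℝ)) :
    Continuous fun μ : ProbabilityMeasure Ω => ∫ ω, P ω ∂(μ : Measure Ω) :=
  ProbabilityMeasure.continuous_integral_boundedContinuousFunction
    (BoundedContinuousFunction.mkOfCompact P)

theorem isAffine_integral (P : C(Ω, ℝ)) :
    IsAffine fun μ : ProbabilityMeasure Ω => ∫ ω, P ω ∂(μ : Measure Ω) := by
  intro μ ν ρ a b _ hρ
  dsimp only
  rw [hρ, integral_add_measure, integral_smul_nnreal_measure, integral_smul_nnreal_measure]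
  · rfl
  · exact (integrable_continuousMap P μ).smul_measure_nnreal
  · exact (integrable_continuousMap P ν).smul_measure_nnreal

/-- An affine continuous function of measures is the integral of its values at Dirac measures. -/
theorem IsAffine.eq_integral {H : ProbabilityMeasure Ω → ℝ} (hH : IsAffine H)
    (hc : Continuous H) (μ : ProbabilityMeasure Ω) :
    H μ = ∫ ω, H (diracProba ω) ∂(μ : Measure Ω) := by
  obtain ⟨y₀⟩ : Nonempty Ω := μ.nonempty
  let P : C(Ω, ℝ) := ⟨fun ω => H (diracProba ω), hc.comp continuous_diracProba⟩
  -- Pushing `μ` forward along simple approximations of the identity gives finitely supported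
  -- measures converging weakly to `μ`; both sides are continuous and agree on them.
  let f : ℕ → SimpleFunc Ω Ω := SimpleFunc.approxOn id measurable_id Set.univ y₀ (Set.mem_univ _)
  have hf (x : Ω) : Tendsto (fun n => f n x) atTop (𝓝 x) :=
    SimpleFunc.tendsto_approxOn measurable_id (Set.mem_univ _) (by simp)
  let ν (n : ℕ) : ProbabilityMeasure Ω := μ.map (f n).measurable.aemeasurable
  have hν : Tendsto ν atTop (𝓝 μ) := by
    rw [ProbabilityMeasure.tendsto_iff_forall_integral_tendsto]
    intro g
    have h1 (n : ℕ) : ∫ ω, g ω ∂(ν n : Measure Ω) = ∫ ω, g (f n ω) ∂(μ : Measure Ω) :=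
      integral_map (f n).measurable.aemeasurable g.continuous.aestronglyMeasurable
    simp only [h1]
    refine tendsto_integral_of_dominated_convergence (fun _ => ‖g‖) (fun n => ?_)
      (integrable_const _) (fun n => Eventually.of_forall fun ω => g.norm_coe_le_norm _)
      (Eventually.of_forall fun ω => (g.continuous.tendsto _).comp (hf ω))
    exact (g.continuous.measurable.comp (f n).measurable).aestronglyMeasurable
  have hn (n : ℕ) : H (ν n) = ∫ ω, P ω ∂(ν n : Measure Ω) := by
    let w (x : Ω) : ℝ≥0 := μ (f n ⁻¹' {x})
    have hρ : (ν n : Measure Ω) = ∑ x ∈ (f n).range, w x • Measure.dirac x := by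
      refine (map_simpleFunc_eq_sum (f n) μ).trans (Finset.sum_congr rfl fun x _ => ?_)
      rw [← ProbabilityMeasure.ennreal_coeFn_eq_coeFn_toMeasure]
      rfl
    have hw : ∑ x ∈ (f n).range, w x = 1 := by
      have h := congrArg (fun m : Measure Ω => m Set.univ) hρ
      simp only [measure_univ, Measure.finsetSum_apply, Measure.smul_apply, ENNReal.smul_def,
        smul_eq_mul, mul_one] at h
      exact_mod_cast h.symm
    rw [hH.eq_sum_of_finite _ w (ν n) hw hρ, hρ, integral_finsetSum_measure]
    · refine Finset.sum_congr rfl fun x _ => ?_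
      rw [integral_smul_nnreal_measure, integral_dirac]
      rfl
    · intro x _
      exact (integrable_continuousMap P (diracProba x)).smul_measure_nnreal
  have h1 : Tendsto (fun n => H (ν n)) atTop (𝓝 (H μ)) := (hc.tendsto μ).comp hν
  simp only [hn] at h1
  exact tendsto_nhds_unique h1 (((continuous_integral_continuousMap P).tendsto μ).comp hν)

/-- Integration of a continuous function against the barycenter of `τ`. -/
theorem integral_bind_continuousMap (τ : ProbabilityMeasure (ProbabilityMeasure Ω))
    (P : C(Ω, ℝ)) :
    ∫ ω, P ω ∂((τ : Measure (ProbabilityMeasure Ω)).bind (fun μ => (μ : Measure Ω))) =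
      ∫ μ, (∫ ω, P ω ∂(μ : Measure Ω)) ∂(τ : Measure (ProbabilityMeasure Ω)) := by
  have hm : Measurable fun μ : ProbabilityMeasure Ω => (μ : Measure Ω) := measurable_subtype_coe
  have hprob := isProbabilityMeasure_bind_coe τ
  set ρ := (τ : Measure (ProbabilityMeasure Ω)).bind (fun μ => (μ : Measure Ω))
  have key (Q : C(Ω, ℝ)) (hQ : ∀ ω, 0 ≤ Q ω) :
      ∫ ω, Q ω ∂ρ = ∫ μ, (∫ ω, Q ω ∂(μ : Measure Ω)) ∂(τ : Measure (ProbabilityMeasure Ω)) := by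
    have h1 (m : Measure Ω) :
        ∫ ω, Q ω ∂m = (∫⁻ ω, ENNReal.ofReal (Q ω) ∂m).toReal :=
      integral_eq_lintegral_of_nonneg_ae (Eventually.of_forall hQ)
        Q.continuous.aestronglyMeasurable
    rw [integral_eq_lintegral_of_nonneg_ae
      (Eventually.of_forall fun μ => integral_nonneg hQ)
      (continuous_integral_continuousMap Q).aestronglyMeasurable, h1,
      Measure.lintegral_bind hm.aemeasurable Q.continuous.measurable.ennreal_ofReal.aemeasurable]
    congr 1
    refine lintegral_congr fun μ => ?_
    exact (ofReal_integral_eq_lintegral_ofReal (integrable_continuousMap Q μ)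
      (Eventually.of_forall hQ)).symm
  -- The shift by `‖P‖` makes the integrand nonnegative; it cancels because all measures have mass
  -- one.
  have h := key (P + ContinuousMap.const Ω ‖P‖) fun ω => by
    have := neg_le_of_abs_le (P.norm_coe_le_norm ω)
    simp only [ContinuousMap.add_apply, ContinuousMap.const_apply]
    linarith
  have h2 (m : Measure Ω) (hm : IsProbabilityMeasure m) :
      ∫ ω, (P + ContinuousMap.const Ω ‖P‖) ω ∂m = ∫ ω, P ω ∂m + ‖P‖ := by
    simp only [ContinuousMap.add_apply, ContinuousMap.const_apply]
    have hi : Integrable P m := integrable_continuousMap P ⟨m, hm⟩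
    rw [integral_add hi (integrable_const _)]
    simp
  rw [h2 ρ hprob] at h
  simp only [h2 _ (ProbabilityMeasure.instIsProbabilityMeasureToMeasure _)] at h
  have hi : Integrable (fun μ : ProbabilityMeasure Ω => ∫ ω, P ω ∂(μ : Measure Ω))
      (τ : Measure (ProbabilityMeasure Ω)) :=
    integrable_continuousMap ⟨_, continuous_integral_continuousMap P⟩ τ
  rw [integral_add hi (integrable_const _)] at h
  simpa using h

theorem isPrimalFeasible_iff_integral {μ₀ : ProbabilityMeasure Ω}
    {τ : ProbabilityMeasure (ProbabilityMeasure Ω)} :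
    IsPrimalFeasible μ₀ τ ↔ ∀ P : C(Ω, ℝ),
      ∫ μ, (∫ ω, P ω ∂(μ : Measure Ω)) ∂(τ : Measure (ProbabilityMeasure Ω)) =
        ∫ ω, P ω ∂(μ₀ : Measure Ω) := by
  rw [isPrimalFeasible_iff_bind]
  refine ⟨fun h P => by rw [← integral_bind_continuousMap, h], fun h => ?_⟩
  have hprob := isProbabilityMeasure_bind_coe τ
  refine ext_of_forall_integral_eq_of_IsFiniteMeasure fun g => ?_
  exact (integral_bind_continuousMap τ g.toContinuousMap).trans (h g.toContinuousMap)

theorem exists_forall_le {V : ProbabilityMeasure Ω → ℝ} (hV : UpperSemicontinuous V) :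
    ∃ M, ∀ μ, V μ ≤ M := by
  obtain ⟨M, hM⟩ := (hV.upperSemicontinuousOn Set.univ).bddAbove_of_isCompact isCompact_univ
  exact ⟨M, fun μ => hM ⟨μ, trivial, rfl⟩⟩

/-- Weak duality. -/
theorem primalValue_le_integral {V : ProbabilityMeasure Ω → ℝ} (hV : UpperSemicontinuous V)
    {μ₀ : ProbabilityMeasure Ω} {τ : ProbabilityMeasure (ProbabilityMeasure Ω)}
    (hτ : IsPrimalFeasible μ₀ τ) {P : C(Ω, ℝ)} (hP : IsDualFeasible V P) :
    primalValue V τ ≤ ((∫ ω, P ω ∂(μ₀ : Measure Ω) : ℝ) : EReal) := by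
  obtain ⟨M, hM⟩ := exists_forall_le hV
  refine primalValue_le_of_forall_integrable hV.measurable hM fun hi => ?_
  rw [← isPrimalFeasible_iff_integral.1 hτ P]
  exact integral_mono hi
    (integrable_continuousMap ⟨_, continuous_integral_continuousMap P⟩ τ) hP

/-! ### Absence of a duality gap -/

/-- The linear map sending a price function to its integral as a function of the measure. -/
noncomputable def integralMap : C(Ω, ℝ) →ₗ[ℝ] C(ProbabilityMeasure Ω, ℝ) where
  toFun P := ⟨_, continuous_integral_continuousMap P⟩
  map_add' P Q := by
    ext μ
    exact integral_add (integrable_continuousMap P μ) (integrable_continuousMap Q μ)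
  map_smul' r P := by
    ext μ
    exact integral_const_mul r _

@[simp]
theorem integralMap_apply (P : C(Ω, ℝ)) (μ : ProbabilityMeasure Ω) :
    integralMap P μ = ∫ ω, P ω ∂(μ : Measure Ω) := rfl

/-- The convex cone of continuous functions lying above a nonnegative multiple of `V - c`. -/
def coneAbove (V : ProbabilityMeasure Ω → ℝ) (c : ℝ) :
    PointedCone ℝ C(ProbabilityMeasure Ω, ℝ) where
  carrier := {g | ∃ t : ℝ, 0 ≤ t ∧ ∀ μ, t * (V μ - c) ≤ g μ}
  zero_mem' := ⟨0, le_rfl, fun μ => by simp⟩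
  smul_mem' := by
    rintro ⟨r, hr⟩ g ⟨t, ht, hg⟩
    refine ⟨r * t, by positivity, fun μ => ?_⟩
    rw [mul_assoc]
    exact mul_le_mul_of_nonneg_left (hg μ) hr
  add_mem' := by
    rintro g g' ⟨t, ht, hg⟩ ⟨t', ht', hg'⟩
    refine ⟨t + t', by positivity, fun μ => ?_⟩
    rw [add_mul]
    exact add_le_add (hg μ) (hg' μ)

/-- A lower bound of the dual problem is attained by some feasible `τ` in the primal problem. -/
theorem exists_isPrimalFeasible_le_primalValue {V : ProbabilityMeasure Ω → ℝ}
    (hV : UpperSemicontinuous V) {μ₀ : ProbabilityMeasure Ω} {c : ℝ}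
    (hc : ∀ P : C(Ω, ℝ), IsDualFeasible V P → c ≤ ∫ ω, P ω ∂(μ₀ : Measure Ω)) :
    ∃ τ : ProbabilityMeasure (ProbabilityMeasure Ω), IsPrimalFeasible μ₀ τ ∧
      (c : EReal) ≤ primalValue V τ := by
  let ev : C(ProbabilityMeasure Ω, ℝ) →ₗ[ℝ] ℝ :=
    { toFun := fun g => g μ₀
      map_add' := fun _ _ => rfl
      map_smul' := fun _ _ => rfl }
  -- Defined as evaluation at `μ₀`, so no choice of a representing price is involved.
  let φ : C(ProbabilityMeasure Ω, ℝ) →ₗ.[ℝ] ℝ :=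
    ⟨LinearMap.range (integralMap (Ω := Ω)), ev.comp (Submodule.subtype _)⟩
  have hconst (r : ℝ) : integralMap (ContinuousMap.const Ω r) = ContinuousMap.const _ r := by
    ext μ; simp
  obtain ⟨L, hLφ, hLnn⟩ := riesz_extension (coneAbove V c) φ (by
      rintro ⟨_, Q, rfl⟩ ⟨t, ht, hQ⟩
      change 0 ≤ ∫ ω, Q ω ∂(μ₀ : Measure Ω)
      change ∀ μ : ProbabilityMeasure Ω, _ ≤ ∫ ω, Q ω ∂(μ : Measure Ω) at hQ
      -- For `t > 0` the price `Q / t + c` is dual feasible, so `c` bounds its value from below.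
      rcases ht.eq_or_lt with rfl | ht
      · simpa using hQ μ₀
      · have heq (μ : ProbabilityMeasure Ω) :
            ∫ ω, (t⁻¹ • Q + ContinuousMap.const Ω c) ω ∂(μ : Measure Ω) =
              t⁻¹ * ∫ ω, Q ω ∂(μ : Measure Ω) + c := by
          rw [← integralMap_apply, map_add, map_smul, hconst]
          rfl
        have hfeas : IsDualFeasible V (t⁻¹ • Q + ContinuousMap.const Ω c) := by
          intro μ
          rw [heq]
          have := mul_le_mul_of_nonneg_left (hQ μ) (inv_nonneg.2 ht.le)
          rw [inv_mul_cancel_left₀ ht.ne'] at this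
          linarith
        have h := hc _ hfeas
        rw [heq] at h
        have h' : 0 ≤ t⁻¹ * ∫ ω, Q ω ∂(μ₀ : Measure Ω) := by linarith
        exact (mul_nonneg_iff_of_pos_left (inv_pos.2 ht)).1 h')
    (by
      intro g
      -- Adding the constant `‖g‖` makes `g` nonnegative, hence in the cone with `t = 0`.
      refine ⟨⟨ContinuousMap.const _ ‖g‖, ContinuousMap.const Ω ‖g‖, hconst _⟩, 0, le_rfl, fun μ => ?_⟩
      have := neg_le_of_abs_le (g.norm_coe_le_norm μ)
      change _ ≤ ‖g‖ + g μ
      linarith)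
  have hLint (P : C(Ω, ℝ)) : L (integralMap P) = ∫ ω, P ω ∂(μ₀ : Measure Ω) :=
    hLφ ⟨integralMap P, P, rfl⟩
  have hLconst (r : ℝ) : L (ContinuousMap.const _ r) = r := by
    rw [← hconst, hLint]; simp
  obtain ⟨τ, hτ⟩ := exists_probabilityMeasure_integral_eq L
    (fun f hf => hLnn f ⟨0, le_rfl, fun μ => by simpa using hf μ⟩) (hLconst 1)
  obtain ⟨M, hM⟩ := exists_forall_le hV
  obtain ⟨hi, hle⟩ := integrable_and_le_integral_of_upperSemicontinuous hV hM
    (τ : Measure (ProbabilityMeasure Ω)) (c := c) fun f hf => by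
      have h := hLnn (f - ContinuousMap.const _ c) ⟨1, zero_le_one, fun μ => by
        simpa using hf μ⟩
      rw [map_sub, hLconst] at h
      rw [hτ f]
      linarith
  refine ⟨τ, isPrimalFeasible_iff_integral.2 fun P => ?_, ?_⟩
  · rw [← hLint, ← hτ]
    rfl
  · rw [primalValue_eq_integral hi]
    exact_mod_cast hle

/-! ### Concave closure and supporting hyperplanes -/

theorem concaveClosure_le_integral {V : ProbabilityMeasure Ω → ℝ} {P : C(Ω, ℝ)}
    (hP : IsDualFeasible V P) (μ : ProbabilityMeasure Ω) :
    concaveClosure V μ ≤ ∫ ω, P ω ∂(μ : Measure Ω) :=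
  csInf_le ⟨V μ, by rintro _ ⟨H, -, -, hH, rfl⟩; exact hH μ⟩
    ⟨_, isAffine_integral P, continuous_integral_continuousMap P, hP, rfl⟩

/-- Every affine continuous majorant is the integral of a dual feasible price. The constant `M`
keeps the infimum away from the default value of `sInf ∅`. -/
theorem le_concaveClosure_of_forall_isDualFeasible {V : ProbabilityMeasure Ω → ℝ}
    (hV : UpperSemicontinuous V) {μ : ProbabilityMeasure Ω} {c : ℝ}
    (hc : ∀ P : C(Ω, ℝ), IsDualFeasible V P → c ≤ ∫ ω, P ω ∂(μ : Measure Ω)) :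
    c ≤ concaveClosure V μ := by
  obtain ⟨M, hM⟩ := exists_forall_le hV
  refine le_csInf ⟨_, _, isAffine_integral (ContinuousMap.const Ω M),
    continuous_integral_continuousMap _, fun ν => by simpa using hM ν, rfl⟩ ?_
  rintro _ ⟨H, hA, hH, hVH, rfl⟩
  rw [hA.eq_integral hH]
  refine hc ⟨fun ω => H (diracProba ω), hH.comp continuous_diracProba⟩ fun ν => ?_
  exact (hVH ν).trans_eq (hA.eq_integral hH ν)

theorem le_concaveClosure {V : ProbabilityMeasure Ω → ℝ} (hV : UpperSemicontinuous V)
    (μ : ProbabilityMeasure Ω) : V μ ≤ concaveClosure V μ :=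
  le_concaveClosure_of_forall_isDualFeasible hV fun _ hP => hP μ

theorem IsSupportingHyperplane.exists_optimal {V : ProbabilityMeasure Ω → ℝ}
    (hV : UpperSemicontinuous V) {μ₀ : ProbabilityMeasure Ω} {Vbar : ProbabilityMeasure Ω → ℝ}
    (h : IsSupportingHyperplane V μ₀ Vbar) :
    ∃ P : C(Ω, ℝ), (∀ ω, P ω = Vbar (diracProba ω)) ∧ IsDualOptimal V μ₀ P ∧
      ∃ τ : ProbabilityMeasure (ProbabilityMeasure Ω),
        IsPrimalOptimal V μ₀ τ ∧ EqualValues V μ₀ τ P := by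
  obtain ⟨hA, hC, h₀, hle⟩ := h
  let P : C(Ω, ℝ) := ⟨fun ω => Vbar (diracProba ω), hC.comp continuous_diracProba⟩
  have hP (μ : ProbabilityMeasure Ω) : Vbar μ = ∫ ω, P ω ∂(μ : Measure Ω) := hA.eq_integral hC μ
  have hfeas : IsDualFeasible V P := fun μ =>
    ((le_concaveClosure hV μ).trans (hle μ)).trans_eq (hP μ)
  have hopt (P' : C(Ω, ℝ)) (hP' : IsDualFeasible V P') :
      ∫ ω, P ω ∂(μ₀ : Measure Ω) ≤ ∫ ω, P' ω ∂(μ₀ : Measure Ω) := by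
    rw [← hP, h₀]
    exact concaveClosure_le_integral hP' μ₀
  -- Here `c` is the dual value of `P` itself, so `τ` closes the gap and weak duality makes it
  -- optimal.
  obtain ⟨τ, hτ, hval⟩ := exists_isPrimalFeasible_le_primalValue hV hopt
  exact ⟨P, fun _ => rfl, ⟨hfeas, hopt⟩, τ,
    ⟨hτ, fun τ' hτ' => (primalValue_le_integral hV hτ' hfeas).trans hval⟩,
    le_antisymm hval (primalValue_le_integral hV hτ hfeas)⟩

theorem IsDualOptimal.exists_isSupportingHyperplane {V : ProbabilityMeasure Ω → ℝ}
    (hV : UpperSemicontinuous V) {μ₀ : ProbabilityMeasure Ω} {P : C(Ω, ℝ)}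
    (hP : IsDualOptimal V μ₀ P) :
    ∃ Vbar : ProbabilityMeasure Ω → ℝ, IsSupportingHyperplane V μ₀ Vbar ∧
      ∀ ω, P ω = Vbar (diracProba ω) := by
  refine ⟨fun μ => ∫ ω, P ω ∂(μ : Measure Ω), ⟨isAffine_integral P,
    continuous_integral_continuousMap P, ?_, concaveClosure_le_integral hP.1⟩, fun ω => ?_⟩
  · exact le_antisymm (le_concaveClosure_of_forall_isDualFeasible hV hP.2)
      (concaveClosure_le_integral hP.1 μ₀)
  · exact (integral_dirac _ ω).symm

end Persuasion

theorem theorem2 {Ω : Type*} [MetricSpace Ω] [CompactSpace Ω] [MeasurableSpace Ω] [BorelSpace Ω]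
    (μ₀ : ProbabilityMeasure Ω) (hμ₀ : (μ₀ : Measure Ω).IsOpenPosMeasure)
    (V : ProbabilityMeasure Ω → ℝ) (hV : UpperSemicontinuous V) :
    (Persuasion.StrongDuality V μ₀ ↔ Persuasion.Regular V μ₀) ∧
    (∀ Vbar : ProbabilityMeasure Ω → ℝ, Persuasion.IsSupportingHyperplane V μ₀ Vbar →
      ∃ P : C(Ω, ℝ), (∀ ω, P ω = Vbar (diracProba ω)) ∧ Persuasion.IsDualOptimal V μ₀ P ∧
        ∃ τ : ProbabilityMeasure (ProbabilityMeasure Ω),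
          Persuasion.IsPrimalOptimal V μ₀ τ ∧ Persuasion.EqualValues V μ₀ τ P) ∧
    (∀ P : C(Ω, ℝ), Persuasion.IsDualOptimal V μ₀ P →
      ∃ Vbar : ProbabilityMeasure Ω → ℝ, Persuasion.IsSupportingHyperplane V μ₀ Vbar ∧
        ∀ ω, P ω = Vbar (diracProba ω)) := by
  refine ⟨⟨?_, ?_⟩, fun Vbar h => h.exists_optimal hV, fun P hP =>
    hP.exists_isSupportingHyperplane hV⟩
  · rintro ⟨τ, P, -, hP, -⟩
    obtain ⟨Vbar, h, -⟩ := hP.exists_isSupportingHyperplane hV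
    exact ⟨Vbar, h⟩
  · rintro ⟨Vbar, h⟩
    obtain ⟨P, -, hP, τ, hτ, heq⟩ := h.exists_optimal hV
    exact ⟨τ, P, hτ, hP, heq⟩
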